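/- For $n\ge 0$, call an element of $\mathrm{GL}(n,\mathbb{C})$ semisimple if it is diagonalizable over $\mathbb{C}$. Call a subgroup of $\mathrm{GL}(n,\mathbb{C})$ unipotent if it is conjugate in $\mathrm{GL}(n,\mathbb{C})$ into the group of upper triangular matrices with ones on the diagonal, and virtually unipotent if it has a unipotent subgroup of finite index. Call a group torsion free if its only element of finite order is the identity. Let $\Lambda<\mathrm{GL}(n,\mathbb{C})$ be a finitely generated group, let $\Gamma<\Lambda$ be a torsion free, virtually unipotent subgroup, and let $C<\Lambda$ be an infinite cyclic subgroup generated by a semisimple element. For a subgroup $H<\Lambda$ let $\mathrm{Cl}(H)$ denote the closure of the image of $H$ in the profinite completion $\widehat{\Lambda}=\varprojlim \Lambda/N$, where $N$ runs over the finite index normal subgroups of $\Lambda$. Then $$\mathrm{Cl}(\Gamma)\cap \mathrm{Cl}(C)=\{1\}.$$ -/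

import Mathlib

namespace LinearGroup

/-- An element of `GL(n, ℂ)` is semisimple if its unipotent Jordan factor is trivial, that is,
if it is conjugate in `GL(n, ℂ)` to a diagonal matrix. -/
def IsSemisimple {n : ℕ} (γ : GL (Fin n) ℂ) : Prop :=
  ∃ g : GL (Fin n) ℂ, ((g * γ * g⁻¹ : GL (Fin n) ℂ) : Matrix (Fin n) (Fin n) ℂ).IsDiag

/-- The matrix is upper triangular with ones along the diagonal. -/
def IsUpperUnitriangular {n : ℕ} (A : Matrix (Fin n) (Fin n) ℂ) : Prop :=
  (∀ i, A i i = 1) ∧ ∀ i j, j < i → A i j = 0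

/-- A subgroup of `GL(n, ℂ)` is unipotent if it is conjugate in `GL(n, ℂ)` into the group of upper
triangular matrices with ones along the diagonal. -/
def IsUnipotent {n : ℕ} (Γ : Subgroup (GL (Fin n) ℂ)) : Prop :=
  ∃ g : GL (Fin n) ℂ, ∀ γ ∈ Γ,
    IsUpperUnitriangular ((g * γ * g⁻¹ : GL (Fin n) ℂ) : Matrix (Fin n) (Fin n) ℂ)

/-- A subgroup of `GL(n, ℂ)` is virtually unipotent if it has a finite index subgroup that is
unipotent. -/
def IsVirtuallyUnipotent {n : ℕ} (Γ : Subgroup (GL (Fin n) ℂ)) : Prop :=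
  ∃ U : Subgroup (GL (Fin n) ℂ), U ≤ Γ ∧ (U.subgroupOf Γ).FiniteIndex ∧ IsUnipotent U

/-- A subgroup is torsion free if its only element of finite order is the identity. (For
noncommutative groups this is weaker than injectivity of the power maps.) -/
def IsTorsionFree {G : Type*} [Group G] (H : Subgroup G) : Prop :=
  ∀ h ∈ H, IsOfFinOrder h → h = 1

/-- The closure, in the profinite completion of `G`, of the image of the subgroup `H` of `G`. -/
def profiniteClosure {G : Type*} [Group G] (H : Subgroup G) :
    Set (ProfiniteGrp.ProfiniteCompletion.completion (GrpCat.of G)) :=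
  closure (ProfiniteGrp.ProfiniteCompletion.etaFn (GrpCat.of G) '' (H : Set G))

end LinearGroup

/-! It suffices to find, for each prime power `l ^ e`, a finite quotient of `Λ` in which `γ = η ^ k`
with `γ ∈ Γ` forces `l ^ e ∣ k`; intersecting kernels over the primes dividing `m` handles every
modulus `m` (`LinearGroup.profiniteClosure_inter_zpowers`).

Being semisimple of infinite order, `η` has an eigenvalue `z` that is not a root of unity, while
some fixed power `d` makes every element of `Γ` unipotent. Realize `Λ` over a finitely generated
ring `A` containing `z`, `z⁻¹` and `l⁻¹`, and reduce it to a finite field by some `φ`. There `γ = η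
^ k` gives `φ(z) ^ (k * d) = 1`, so it is enough that a large power of `l` divides the order of
`φ(z)` (`exists_finite_field_dvd_orderOf`).

Such a `φ` is reduction modulo a maximal ideal containing `1 + z ^ m + ⋯ + z ^ ((l - 1) * m)` with
`l ^ e ∣ m`, so this sum must be a non-unit for some `m` (`exists_geom_sum_not_isUnit`). For
transcendental `z` this follows from Chevalley's theorem. For algebraic `z`, specialize `A` to a
number field: if all these sums were `S`-units, recurrence of powers would bound them below at every
place of `S` and make them large at one, against the product formula. -/

/-! ### Closures in the profinite completion -/

open ProfiniteGrp.ProfiniteCompletion in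
/-- A point in the closure of the image of `H` has, at each finite quotient, a coordinate
represented by an element of `H`. -/
theorem LinearGroup.exists_mem_of_mem_profiniteClosure {G : Type*} [Group G] {H : Subgroup G}
    {x : completion (GrpCat.of G)} (hx : x ∈ LinearGroup.profiniteClosure H)
    (N : FiniteIndexNormalSubgroup G) :
    ∃ h ∈ H, x.val N = (QuotientGroup.mk h : G ⧸ N.toSubgroup) := by
  let p : completion (GrpCat.of G) → (G ⧸ N.toSubgroup) := fun y => y.val N
  let _ : TopologicalSpace (G ⧸ N.toSubgroup) := ⊥
  have : DiscreteTopology (G ⧸ N.toSubgroup) := ⟨rfl⟩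
  have hp : Continuous p :=
    (continuous_apply (A := fun j => ((diagram (GrpCat.of G)).obj j : Type _)) N).comp
      continuous_subtype_val
  have := mem_closure_iff.1 hx (p ⁻¹' {p x}) ((isOpen_discrete _).preimage hp) rfl
  obtain ⟨_, hy, h, hh, rfl⟩ := this
  exact ⟨h, hh, hy.symm⟩

/-- If a finite index normal subgroup controls exponents modulo every `m`, then the closures of `H`
and of the cyclic group of `c` meet trivially. -/
theorem LinearGroup.profiniteClosure_inter_zpowers {G : Type*} [Group G] {H : Subgroup G} {c : G}
    (h : ∀ m : ℕ, 0 < m → ∃ M : Subgroup G, M.Normal ∧ M.FiniteIndex ∧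
      ∀ γ ∈ H, ∀ k : ℤ, γ⁻¹ * c ^ k ∈ M → (m : ℤ) ∣ k) :
    LinearGroup.profiniteClosure H ∩ LinearGroup.profiniteClosure (Subgroup.zpowers c) = {1} := by
  apply Set.eq_singleton_iff_unique_mem.2
  refine ⟨⟨subset_closure ⟨1, one_mem _, rfl⟩, subset_closure ⟨1, one_mem _, rfl⟩⟩, ?_⟩
  rintro x ⟨hx, hx'⟩
  apply Subtype.ext
  funext N
  -- The modulus is the index of `N`, because `c` raised to that index lies in `N`.
  obtain ⟨M, hM, hM', hk⟩ := h N.toSubgroup.index (Nat.pos_of_ne_zero Subgroup.FiniteIndex.index_ne_zero)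
  let K : FiniteIndexNormalSubgroup G := { toSubgroup := M ⊓ N.toSubgroup }
  have hKN : K ≤ N := fun _ h => h.2
  obtain ⟨γ, hγ, e1⟩ := LinearGroup.exists_mem_of_mem_profiniteClosure hx K
  obtain ⟨_, ⟨k, rfl⟩, e2⟩ := LinearGroup.exists_mem_of_mem_profiniteClosure hx' K
  have e3 := QuotientGroup.eq.1 (e1.symm.trans e2)
  obtain ⟨j, rfl⟩ := hk γ hγ k e3.1
  have e4 : x.val N = (QuotientGroup.mk (c ^ ((N.toSubgroup.index : ℤ) * j)) : G ⧸ N.toSubgroup) := by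
    have := x.property (CategoryTheory.homOfLE hKN)
    rw [← this, e2]
    rfl
  rw [e4]
  refine (QuotientGroup.eq_one_iff _).2 ?_
  rw [zpow_mul, zpow_natCast]
  exact zpow_mem (N.toSubgroup.pow_index_mem c) j

/-! ### Unipotent and semisimple matrices -/

theorem LinearGroup.IsUnipotent.sub_one_pow_eq_zero {n : ℕ} {U : Subgroup (GL (Fin n) ℂ)}
    (hU : LinearGroup.IsUnipotent U) {γ : GL (Fin n) ℂ} (hγ : γ ∈ U) :
    ((γ : Matrix (Fin n) (Fin n) ℂ) - 1) ^ n = 0 := by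
  obtain ⟨g, hg⟩ := hU
  obtain ⟨h1, h2⟩ := hg γ hγ
  have ht : ((g * γ * g⁻¹ : GL (Fin n) ℂ) : Matrix (Fin n) (Fin n) ℂ).charpoly =
      (Polynomial.X - 1) ^ n := by
    rw [Matrix.charpoly_of_isUpperTriangular _ (fun i j hij => h2 i j hij)]
    simp [h1]
  have : (γ : Matrix (Fin n) (Fin n) ℂ).charpoly = (Polynomial.X - 1) ^ n := by
    rw [← ht]
    push_cast
    exact (Matrix.charpoly_units_conj g _).symm
  have h3 := Matrix.aeval_self_charpoly (γ : Matrix (Fin n) (Fin n) ℂ)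
  rw [this] at h3
  simpa using h3

theorem LinearGroup.IsVirtuallyUnipotent.exists_pow {n : ℕ} {Γ : Subgroup (GL (Fin n) ℂ)}
    (hΓ : LinearGroup.IsVirtuallyUnipotent Γ) :
    ∃ d : ℕ, 0 < d ∧ ∀ γ ∈ Γ, ((γ : Matrix (Fin n) (Fin n) ℂ) ^ d - 1) ^ n = 0 := by
  obtain ⟨U, hUΓ, hfin, hU⟩ := hΓ
  refine ⟨(U.subgroupOf Γ).index.factorial, Nat.factorial_pos _, fun γ hγ => ?_⟩
  have : γ ^ (U.subgroupOf Γ).index.factorial ∈ U := by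
    obtain ⟨i, hi, hle, hmem⟩ := Subgroup.exists_pow_mem_of_index_ne_zero
      (H := U.subgroupOf Γ) Subgroup.FiniteIndex.index_ne_zero ⟨γ, hγ⟩
    obtain ⟨c, hc⟩ := Nat.dvd_factorial hi hle
    rw [hc, pow_mul]
    exact pow_mem (by simpa [Subgroup.mem_subgroupOf] using hmem) c
  simpa using hU.sub_one_pow_eq_zero this

/-- A diagonal matrix whose entries are all roots of unity has finite order. Semisimplicity is
essential: a nontrivial unipotent element has infinite order but only the eigenvalue one. -/
theorem LinearGroup.IsSemisimple.exists_eigenvalue {n : ℕ} {η : GL (Fin n) ℂ}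
    (hη : LinearGroup.IsSemisimple η) (hinf : ¬ IsOfFinOrder η) :
    ∃ z : ℂ, z ≠ 0 ∧ (∀ k : ℕ, 0 < k → z ^ k ≠ 1) ∧
      (Matrix.scalar (Fin n) z - (η : Matrix (Fin n) (Fin n) ℂ)).det = 0 := by
  obtain ⟨g, hg⟩ := hη
  set D := g * η * g⁻¹ with hD
  have hdiag := hg.diagonal_diag
  set f := (D : Matrix (Fin n) (Fin n) ℂ).diag with hf
  have hchar : (η : Matrix (Fin n) (Fin n) ℂ).charpoly = (Matrix.diagonal f).charpoly := by
    rw [hdiag, hD]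
    push_cast
    exact (Matrix.charpoly_units_conj g _).symm
  by_contra! hcon
  apply hinf
  have hfin : ∀ i, ∃ k : ℕ, 0 < k ∧ f i ^ k = 1 := by
    intro i
    by_contra! hi
    refine hcon (f i) ?_ hi ?_
    · intro h0
      have : IsUnit (D : Matrix (Fin n) (Fin n) ℂ).det := (Matrix.isUnit_iff_isUnit_det _).1 D.isUnit
      rw [← hdiag, Matrix.det_diagonal, Finset.prod_eq_zero (Finset.mem_univ i) h0] at this
      simp at this
    · rw [← Matrix.eval_charpoly, hchar, Matrix.charpoly_diagonal, Polynomial.eval_prod]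
      exact Finset.prod_eq_zero (Finset.mem_univ i) (by simp)
  choose k hk hk1 using hfin
  have hD1 : IsOfFinOrder D := by
    refine isOfFinOrder_iff_pow_eq_one.2 ⟨∏ i, k i, Finset.prod_pos fun i _ => hk i, ?_⟩
    ext1
    push_cast
    rw [← hdiag, Matrix.diagonal_pow, ← Matrix.diagonal_one]
    congr 1
    funext i
    obtain ⟨c, hc⟩ := Finset.dvd_prod_of_mem k (Finset.mem_univ i)
    rw [hc, Pi.pow_apply, pow_mul, hk1, one_pow]
  obtain ⟨m, hm, hm1⟩ := isOfFinOrder_iff_pow_eq_one.1 hD1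
  refine isOfFinOrder_iff_pow_eq_one.2 ⟨m, hm, ?_⟩
  rwa [hD, conj_pow, conj_eq_one_iff] at hm1

/-! ### Bounds for geometric sums, and recurrence of powers -/

section

open Finset

/-- A lower bound for `1 + x ^ m + ⋯ + x ^ ((q - 1) m)` when `x` has absolute value less than
one. -/
theorem AbsoluteValue.half_le_geom_sum_of_lt_one {K : Type*} [Field K] (f : AbsoluteValue K ℝ)
    {x : K} (hx : f x < 1) {q : ℕ} (hq : 0 < q) :
    ∃ M : ℕ, ∀ m ≥ M, 1 / 2 ≤ f (∑ i ∈ range q, (x ^ m) ^ i) := by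
  have ht : Filter.Tendsto (fun m : ℕ => (q : ℝ) * f x ^ m) Filter.atTop (nhds 0) := by
    simpa using (tendsto_pow_atTop_nhds_zero_of_lt_one (f.nonneg x) hx).const_mul (q : ℝ)
  obtain ⟨M, hM⟩ := Filter.eventually_atTop.1 (ht.eventually_le_const (show (0 : ℝ) < 1 / 2 by norm_num))
  refine ⟨M, fun m hm => ?_⟩
  obtain ⟨r, rfl⟩ : ∃ r, q = r + 1 := ⟨q - 1, by omega⟩
  have h1 : f (∑ i ∈ range r, (x ^ m) ^ (i + 1)) ≤ 1 / 2 := by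
    refine le_trans (f.sum_le _ _) (le_trans (sum_le_card_nsmul _ _ (f x ^ m) ?_) ?_)
    · intro i _
      rw [map_pow, map_pow]
      exact pow_le_of_le_one (by positivity) (pow_le_one₀ (f.nonneg x) hx.le) (by omega)
    · have := hM m hm
      have h0 : 0 ≤ f x ^ m := by positivity
      simp only [card_range, nsmul_eq_mul]
      push_cast at this
      linarith
  have h2 : (1 : K) = ∑ i ∈ range (r + 1), (x ^ m) ^ i - ∑ i ∈ range r, (x ^ m) ^ (i + 1) := by
    rw [sum_range_succ']
    simp
  have h3 : f 1 ≤ _ := h2 ▸ f.sub_le_add (∑ i ∈ range (r + 1), (x ^ m) ^ i) _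
  rw [map_one] at h3
  linarith

theorem AbsoluteValue.le_geom_sum_of_one_lt {K : Type*} [Field K] (f : AbsoluteValue K ℝ)
    {x : K} (hx : 1 < f x) {q : ℕ} (hq : 2 ≤ q) (C : ℝ) :
    ∃ M : ℕ, ∀ m ≥ M, C ≤ f (∑ i ∈ range q, (x ^ m) ^ i) := by
  obtain ⟨M, hM⟩ := Filter.eventually_atTop.1
    ((tendsto_pow_atTop_atTop_of_one_lt hx).eventually_ge_atTop (max (C + 1) 2))
  refine ⟨M, fun m hm => ?_⟩
  have ha := hM m hm
  rw [← map_pow] at ha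
  set y := x ^ m
  have h1 : f (∑ i ∈ range q, y ^ i) * f (y - 1) = f (y ^ q - 1) := by
    rw [← map_mul, geom_sum_mul]
  have h2 : f (y - 1) ≤ f y + 1 := by simpa using f.sub_le_add y 1
  have h3 : f y ^ q - 1 ≤ f (y ^ q - 1) := by
    simpa using f.le_sub (y ^ q) 1
  have hy1 : C + 1 ≤ f y := le_trans (le_max_left _ _) ha
  have hy2 : 2 ≤ f y := le_trans (le_max_right _ _) ha
  have h4 : f y ^ 2 ≤ f y ^ q := pow_le_pow_right₀ (by linarith) hq
  have h5 : (f y - 1) * (f y + 1) ≤ f (∑ i ∈ range q, y ^ i) * (f y + 1) := by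
    nlinarith [mul_le_mul_of_nonneg_left h2 (f.nonneg (∑ i ∈ range q, y ^ i))]
  have := le_of_mul_le_mul_right h5 (by linarith)
  linarith

/-- Near `y = 1` the sum is close to `q`. The bound involves `f q`, which may be less than one at a
finite place; only the triangle inequality is used, so all places are covered. -/
theorem AbsoluteValue.half_le_geom_sum_of_eq_one {K : Type*} [Field K] (f : AbsoluteValue K ℝ)
    {q : ℕ} (hq : 0 < f q) :
    ∃ δ > 0, ∀ y : K, f y = 1 → f (y - 1) < δ → f q / 2 ≤ f (∑ i ∈ range q, y ^ i) := by
  have hq0 : 0 < q := Nat.pos_of_ne_zero (by rintro rfl; simp at hq)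
  refine ⟨f q / (2 * q ^ 2), by positivity, fun y hy hyδ => ?_⟩
  have h1 : f (∑ i ∈ range q, (y ^ i - 1)) ≤ f q / 2 := by
    refine le_trans (f.sum_le _ _) (le_trans (sum_le_card_nsmul _ _ (q * f (y - 1)) ?_) ?_)
    · intro i hi
      rw [← geom_sum_mul, map_mul]
      refine mul_le_mul_of_nonneg_right (le_trans (f.sum_le _ _) ?_) (f.nonneg _)
      simp only [map_pow, hy, one_pow, sum_const, card_range, nsmul_eq_mul, mul_one]
      exact_mod_cast (mem_range.1 hi).le
    · simp only [card_range, nsmul_eq_mul]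
      have h2 : (q : ℝ) * (q * f (y - 1)) ≤ q * (q * (f q / (2 * q ^ 2))) := by gcongr
      refine h2.trans (le_of_eq ?_)
      field_simp
  have h2 : (q : K) = ∑ i ∈ range q, y ^ i - ∑ i ∈ range q, (y ^ i - 1) := by
    rw [← sum_sub_distrib]
    simp
  have h3 : f q ≤ f (∑ i ∈ range q, y ^ i) + f (∑ i ∈ range q, (y ^ i - 1)) := by
    conv_lhs => rw [h2]
    exact f.sub_le_add _ _
  linarith

/-- Simultaneous recurrence of powers for finitely many complex numbers. -/
theorem Complex.exists_pow_near_one {ι : Type*} [Fintype ι] (z : ι → ℂ) {ε : ℝ} (hε : 0 < ε)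
    (M : ℕ) : ∃ m ≥ M, ∀ i, ‖z i‖ = 1 → ‖z i ^ m - 1‖ < ε := by
  classical
  -- Zeroing the coordinates off the unit circle keeps all powers in a compact ball; the exponent
  -- sought is a difference of two indices of a convergent subsequence.
  let y : ι → ℂ := fun i => if ‖z i‖ = 1 then z i else 0
  have hy : ∀ i, ‖y i‖ ≤ 1 := fun i => by
    by_cases h : ‖z i‖ = 1 <;> simp [y, h]
  obtain ⟨a, -, φ, hφ, ha⟩ := (isCompact_closedBall (0 : ι → ℂ) 1).tendsto_subseq
    (x := fun k i => y i ^ k) (fun k => by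
      rw [mem_closedBall_zero_iff, pi_norm_le_iff_of_nonneg zero_le_one]
      exact fun i => by simpa using pow_le_one₀ (norm_nonneg _) (hy i))
  obtain ⟨N, hN⟩ := Metric.cauchySeq_iff.1 ha.cauchySeq ε hε
  have hgt : φ N + M ≤ φ (N + (φ N + M)) := (Nat.le_add_left _ _).trans (hφ.le_apply)
  refine ⟨φ (N + (φ N + M)) - φ N, by omega, fun i hi => ?_⟩
  have h1 := hN (N + (φ N + M)) (by omega) N le_rfl
  have h2 := lt_of_le_of_lt (dist_le_pi_dist _ _ i) h1
  simp only [Function.comp, y, if_pos hi, dist_eq_norm] at h2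
  have h3 : z i ^ φ (N + (φ N + M)) - z i ^ φ N =
      z i ^ φ N * (z i ^ (φ (N + (φ N + M)) - φ N) - 1) := by
    rw [mul_sub, ← pow_add, mul_one]
    congr 2
    omega
  rwa [h3, norm_mul, norm_pow, hi, one_pow, one_mul] at h2

theorem AbsoluteValue.sub_one_le_of_isNonarchimedean {K : Type*} [Field K] (f : AbsoluteValue K ℝ)
    (hf : IsNonarchimedean f) {y : K} (hy : f y = 1) (k : ℕ) : f (y ^ k - 1) ≤ f (y - 1) := by
  rw [← geom_sum_mul, map_mul]
  refine mul_le_of_le_one_left (f.nonneg _) ?_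
  induction k with
  | zero => simp
  | succ k ih =>
    rw [sum_range_succ]
    exact (hf _ _).trans (max_le ih (by simp [hy]))

end

/-! ### Places of number fields and the product formula -/

section

open Finset NumberField

theorem NumberField.FinitePlace.le_one_iff_valuation_le_one {K : Type*} [Field K] [NumberField K]
    (v : FinitePlace K) (x : K) : v x ≤ 1 ↔ v.maximalIdeal.valuation K x ≤ 1 := by
  rw [← FinitePlace.norm_embedding_eq, FinitePlace.norm_embedding']
  have h := (WithZeroMulInt.toNNReal_strictMono
    (HeightOneSpectrum.one_lt_absNorm_nnreal v.maximalIdeal)).le_iff_le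
    (a := v.maximalIdeal.valuation K x) (b := 1)
  rw [map_one] at h
  exact_mod_cast h

theorem NumberField.FinitePlace.lt_iff_valuation_lt {K : Type*} [Field K] [NumberField K]
    (v : FinitePlace K) (x y : K) :
    v x < v y ↔ v.maximalIdeal.valuation K x < v.maximalIdeal.valuation K y := by
  simp_rw [← FinitePlace.norm_embedding_eq, FinitePlace.norm_embedding']
  have h := (WithZeroMulInt.toNNReal_strictMono
    (HeightOneSpectrum.one_lt_absNorm_nnreal v.maximalIdeal)).lt_iff_lt
    (a := v.maximalIdeal.valuation K x) (b := v.maximalIdeal.valuation K y)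
  exact_mod_cast h

/-- Pigeonhole: approximate the powers of `x` by algebraic integers; two of these agree modulo `p ^
N`, where `p` lies in the prime of `v`. -/
theorem NumberField.FinitePlace.exists_pow_near_one {K : Type*} [Field K] [NumberField K]
    (v : FinitePlace K) {x : K} (hx : v x = 1) {ε : ℝ} (hε : 0 < ε) :
    ∃ t : ℕ, 0 < t ∧ v (x ^ t - 1) < ε := by
  obtain ⟨p, hp, hp0⟩ := Submodule.exists_mem_ne_zero_of_ne_bot v.maximalIdeal.ne_bot
  have hp1 : v (p : K) < 1 := by
    rw [← FinitePlace.norm_embedding_eq]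
    exact (FinitePlace.norm_lt_one_iff_mem K v.maximalIdeal p).2 hp
  obtain ⟨N, hN⟩ := exists_pow_lt_of_lt_one hε hp1
  have hpK : ((p ^ N : 𝓞 K) : K) ≠ 0 := by
    simpa using fun h => absurd h hp0
  have hc : ∀ k : ℕ, ∃ a : 𝓞 K, v ((a : K) - x ^ k) < v ((p ^ N : 𝓞 K) : K) := by
    intro k
    obtain ⟨a, ha⟩ := v.maximalIdeal.exists_valuation_sub_lt_of_integer
      (x := x ^ k) ((v.le_one_iff_valuation_le_one _).1 (by simp [hx]))
      (Units.mk0 (v.maximalIdeal.valuation K ((p ^ N : 𝓞 K) : K)) (by simpa using hpK))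
    exact ⟨a, (v.lt_iff_valuation_lt _ _).2 ha⟩
  choose a ha using hc
  have : Finite (𝓞 K ⧸ Ideal.span {p ^ N}) :=
    Ideal.finiteQuotientOfFreeOfNeBot _ (by simpa using fun h => absurd h hp0)
  obtain ⟨i, j, hij, he⟩ := Finite.exists_ne_map_eq_of_infinite
    (fun k : ℕ => Ideal.Quotient.mk (Ideal.span {p ^ N}) (a k))
  wlog hlt : i < j generalizing i j
  · exact this j i hij.symm he.symm (lt_of_le_of_ne (not_lt.1 hlt) hij.symm)
  obtain ⟨c, hc⟩ := Ideal.mem_span_singleton.1 (Ideal.Quotient.eq.1 he)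
  have hπ : v ((p ^ N : 𝓞 K) : K) < ε := by simpa using hN
  have hac : v ((a i : K) - a j) < ε := by
    refine lt_of_le_of_lt ?_ hπ
    have : (a i : K) - a j = ((p ^ N : 𝓞 K) : K) * (c : K) := by
      rw [← map_sub, hc, map_mul]
    rw [this, map_mul]
    refine mul_le_of_le_one_right (apply_nonneg v _) ?_
    rw [← FinitePlace.norm_embedding_eq]
    exact FinitePlace.norm_le_one K v.maximalIdeal c
  refine ⟨j - i, by omega, ?_⟩
  have h1 : v (x ^ j - x ^ i) < ε := by
    have e : x ^ j - x ^ i = (((a i : K) - x ^ i) + -((a i : K) - a j)) + -((a j : K) - x ^ j) := by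
      ring
    rw [e]
    refine (v.add_le _ _).trans_lt (max_lt ((v.add_le _ _).trans_lt (max_lt ?_ ?_)) ?_)
    · exact (ha i).trans hπ
    · rwa [map_neg_eq_map]
    · rw [map_neg_eq_map]
      exact (ha j).trans hπ
  have h2 : x ^ j - x ^ i = x ^ i * (x ^ (j - i) - 1) := by
    rw [mul_sub, ← pow_add, mul_one]
    congr 2
    omega
  rwa [h2, map_mul, map_pow, hx, one_pow, one_mul] at h1

/-- Simultaneous recurrence of the powers of `x` at all infinite places and at finitely many finite
places where `x` has absolute value one. -/
theorem NumberField.exists_pow_near_one {K : Type*} [Field K] [NumberField K]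
    (S : Finset (FinitePlace K)) (x : K) {ε : ℝ} (hε : 0 < ε) {q : ℕ} (hq : 0 < q) (M : ℕ) :
    ∃ m ≥ M, q ∣ m ∧ (∀ w : InfinitePlace K, w x = 1 → w (x ^ m - 1) < ε) ∧
      ∀ v ∈ S, v x = 1 → v (x ^ m - 1) < ε := by
  have h1 : ∀ v : FinitePlace K, ∃ t : ℕ, 0 < t ∧ (v x = 1 → v (x ^ t - 1) < ε) := fun v => by
    by_cases h : v x = 1
    · obtain ⟨t, ht, h'⟩ := v.exists_pow_near_one h hε
      exact ⟨t, ht, fun _ => h'⟩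
    · exact ⟨1, one_pos, fun h' => absurd h' h⟩
  choose t ht htε using h1
  have hT : 0 < ∏ v ∈ S, t v := prod_pos fun v _ => ht v
  -- Recurrence at the infinite places is applied to a power already good at the finite ones, where
  -- closeness to one survives passing to multiples of the exponent.
  obtain ⟨m, hm, hmz⟩ := Complex.exists_pow_near_one
    (fun w : InfinitePlace K => w.embedding (x ^ (q * ∏ v ∈ S, t v))) hε M
  refine ⟨q * (∏ v ∈ S, t v) * m, hm.trans (Nat.le_mul_of_pos_left _ (by positivity)),
    ⟨_, mul_assoc _ _ _⟩, fun w hw => ?_, fun v hv hvx => ?_⟩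
  · have := hmz w (by rw [InfinitePlace.norm_embedding_eq, map_pow, hw, one_pow])
    rwa [← map_pow, ← map_one w.embedding, ← map_sub, InfinitePlace.norm_embedding_eq,
      ← pow_mul] at this
  · obtain ⟨c, hc⟩ := dvd_prod_of_mem t hv
    have e : q * (∏ v ∈ S, t v) * m = t v * (q * c * m) := by rw [hc]; ring
    rw [e, pow_mul]
    exact lt_of_le_of_lt (AbsoluteValue.sub_one_le_of_isNonarchimedean v.1 v.add_le
      (by rw [map_pow, ← FinitePlace.coe_apply, hvx, one_pow]) _) (htε v hvx)

/-- Otherwise `x` is an algebraic integer with all conjugates in the unit disc, hence a root of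
unity by Kronecker. -/
theorem NumberField.exists_place_one_lt {K : Type*} [Field K] [NumberField K]
    {x : K} (hx0 : x ≠ 0) (hx : ∀ k : ℕ, 0 < k → x ^ k ≠ 1) (hfin : ∀ v : FinitePlace K, v x ≤ 1) :
    ∃ w : InfinitePlace K, 1 < w x := by
  by_contra! h
  have hint : IsIntegral ℤ x := by
    obtain ⟨y, rfl⟩ := IsDedekindDomain.HeightOneSpectrum.mem_integers_of_valuation_le_one
      (R := 𝓞 K) K x fun v => by
        have := (FinitePlace.le_one_iff_valuation_le_one (FinitePlace.mk v) x).1 (hfin _)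
        rwa [FinitePlace.maximalIdeal_mk] at this
    exact y.isIntegral_coe
  obtain ⟨k, hk, hk1⟩ := NumberField.Embeddings.pow_eq_one_of_norm_le_one K ℂ hx0 hint
    fun φ => by simpa using h (InfinitePlace.mk φ)
  exact hx k hk hk1

end

section

open Finset NumberField

/-- Positive lower bounds on all factors and a large enough one on a single factor make a finite
product exceed one. -/
theorem Finset.one_lt_prod_pow_of_large {ι : Type*} [Fintype ι] [DecidableEq ι] (c : ι → ℝ)
    (hc : ∀ i, 0 < c i) (e : ι → ℕ) (he : ∀ i, 0 < e i) (i₀ : ι) :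
    ∃ C : ℝ, ∀ a : ι → ℝ, (∀ i, c i ≤ a i) → C ≤ a i₀ → 1 < ∏ i, a i ^ e i := by
  have hP : 0 < ∏ i, c i ^ e i := prod_pos fun i _ => pow_pos (hc i) _
  refine ⟨2 * c i₀ / ∏ i, c i ^ e i, fun a ha hC => ?_⟩
  have h1 : ∀ i, 1 ≤ a i / c i := fun i => (one_le_div (hc i)).2 (ha i)
  have h2 : a i₀ / c i₀ ≤ ∏ i, (a i / c i) ^ e i :=
    (le_self_pow₀ (h1 i₀) (he i₀).ne').trans
      (by
        rw [← mul_prod_erase univ _ (mem_univ i₀)]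
        refine le_mul_of_one_le_right (by have := h1 i₀; positivity) ?_
        exact one_le_prod fun i _ => one_le_pow₀ (h1 i))
  have h3 : ∏ i, a i ^ e i = (∏ i, c i ^ e i) * ∏ i, (a i / c i) ^ e i := by
    rw [← prod_mul_distrib]
    refine prod_congr rfl fun i _ => ?_
    rw [← mul_pow, mul_div_cancel₀ _ (hc i).ne']
  rw [h3]
  have h4 : 2 / (∏ i, c i ^ e i) ≤ a i₀ / c i₀ := by
    rw [le_div_iff₀ (hc i₀)]
    calc _ = 2 * c i₀ / ∏ i, c i ^ e i := by ring
      _ ≤ _ := hC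
  calc (1 : ℝ) < 2 := one_lt_two
    _ = (∏ i, c i ^ e i) * (2 / ∏ i, c i ^ e i) := by field_simp
    _ ≤ _ := by gcongr; exact h4.trans h2

/-- For a number `x` which is not a root of unity, the numbers `1 + x ^ m + ⋯ + x ^ ((q - 1) m)`
cannot all be `S`-units. -/
theorem NumberField.exists_geom_sum_ne_one {K : Type*} [Field K] [NumberField K]
    (S : Finset (FinitePlace K)) {x : K} (hx0 : x ≠ 0) (hx : ∀ k : ℕ, 0 < k → x ^ k ≠ 1)
    (hS : ∀ v ∉ S, v x ≤ 1) {q d : ℕ} (hq : 2 ≤ q) (hd : 0 < d) :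
    ∃ m : ℕ, 0 < m ∧ d ∣ m ∧ ∃ v ∉ S, v (∑ i ∈ range q, (x ^ m) ^ i) ≠ 1 := by
  classical
  let f : InfinitePlace K ⊕ S → AbsoluteValue K ℝ := Sum.elim (fun w => w.1) (fun v => v.1.1)
  have hf1 : ∀ (w : InfinitePlace K) (y : K), f (.inl w) y = w y := fun _ _ => rfl
  have hf2 : ∀ (v : S) (y : K), f (.inr v) y = v.1 y := fun _ _ => rfl
  let e : InfinitePlace K ⊕ S → ℕ := Sum.elim (fun w => w.mult) (fun _ => 1)
  have he : ∀ i, 0 < e i := by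
    rintro (w | v)
    · exact InfinitePlace.mult_pos
    · exact one_pos
  obtain ⟨i₀, hi₀⟩ : ∃ i, 1 < f i x := by
    by_cases h : ∃ v ∈ S, 1 < v x
    · obtain ⟨v, hv, hv1⟩ := h
      exact ⟨.inr ⟨v, hv⟩, hv1⟩
    · push Not at h
      obtain ⟨w, hw⟩ := NumberField.exists_place_one_lt hx0 hx fun v =>
        if hv : v ∈ S then h v hv else hS v hv
      exact ⟨.inl w, hw⟩
  have hbd : ∀ i, ∃ c > 0, ∃ δ > 0, ∃ M : ℕ, ∀ m ≥ M, (f i x = 1 → f i (x ^ m - 1) < δ) →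
      c ≤ f i (∑ j ∈ range q, (x ^ m) ^ j) := by
    intro i
    rcases lt_trichotomy (f i x) 1 with h | h | h
    · obtain ⟨M, hM⟩ := (f i).half_le_geom_sum_of_lt_one h (by omega : 0 < q)
      exact ⟨1 / 2, by norm_num, 1, one_pos, M, fun m hm _ => hM m hm⟩
    · have hq0 : 0 < f i q := (f i).pos (by exact_mod_cast (by omega : q ≠ 0))
      obtain ⟨δ, hδ, h'⟩ := (f i).half_le_geom_sum_of_eq_one hq0
      exact ⟨_, half_pos hq0, δ, hδ, 0, fun m _ hm => h' _ (by rw [map_pow, h, one_pow]) (hm h)⟩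
    · obtain ⟨M, hM⟩ := (f i).le_geom_sum_of_one_lt h hq 1
      exact ⟨1, one_pos, 1, one_pos, M, fun m hm _ => hM m hm⟩
  choose c hc δ hδ M hM using hbd
  obtain ⟨C, hC⟩ := Finset.one_lt_prod_pow_of_large c hc e he i₀
  obtain ⟨M₀, hM₀⟩ := (f i₀).le_geom_sum_of_one_lt hi₀ hq C
  have : Nonempty (InfinitePlace K ⊕ S) := ⟨i₀⟩
  obtain ⟨m, hm, hdm, hm1, hm2⟩ := NumberField.exists_pow_near_one S x
    (ε := univ.inf' univ_nonempty δ) (by simpa using hδ) hd (univ.sup M + M₀ + 1)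
  refine ⟨m, by omega, hdm, ?_⟩
  by_contra! hcon
  set u := ∑ i ∈ range q, (x ^ m) ^ i with hu
  have hu0 : u ≠ 0 := by
    intro h0
    have := geom_sum_mul (x ^ m) q
    rw [← hu, h0, zero_mul, ← pow_mul] at this
    exact hx (m * q) (Nat.mul_pos (by omega) (by omega)) (sub_eq_zero.1 this.symm)
  have hlow : ∀ i, c i ≤ f i u := fun i => by
    refine hM i m ?_ fun hi => ?_
    · have := le_sup (f := M) (mem_univ i)
      omega
    · refine lt_of_lt_of_le ?_ (inf'_le δ (mem_univ i))
      rcases i with w | v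
      · exact hm1 w hi
      · exact hm2 v.1 v.2 hi
  have h1 := hC (fun i => f i u) hlow (hM₀ m (by omega))
  -- By `hcon` the places outside `S` contribute nothing, so the product formula contradicts `h1`.
  have h2 := prod_abs_eq_one (K := K) hu0
  rw [finprod_eq_prod_of_mulSupport_subset (s := S) _ (fun v hv => by
    by_contra hvS
    exact hv (hcon v hvS))] at h2
  rw [Fintype.prod_sum_type, prod_coe_sort_eq_attach] at h1
  simp only [hf1, hf2, e, Sum.elim_inl, Sum.elim_inr, pow_one] at h1
  rw [prod_attach S (fun v => v u), h2] at h1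
  exact lt_irrefl _ h1

end

/-! ### Specializing finitely generated rings -/

theorem Algebra.FiniteType.exists_algHom_finite_field.{u} (k : Type*) (B : Type u) [Field k] [CommRing B]
    [Nontrivial B] [Algebra k B] [Algebra.FiniteType k B] :
    ∃ (K : Type u) (_ : Field K) (_ : Algebra k K) (_ : Module.Finite k K),
      Nonempty (B →ₐ[k] K) := by
  obtain ⟨m, hm⟩ := Ideal.exists_maximal B
  let _ := Ideal.Quotient.field m
  have : Algebra.FiniteType k (B ⧸ m) :=
    Algebra.FiniteType.of_surjective (Ideal.Quotient.mkₐ k m) (Ideal.Quotient.mkₐ_surjective k m)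
  exact ⟨B ⧸ m, inferInstance, inferInstance, finite_of_finite_type_of_isJacobsonRing k (B ⧸ m),
    ⟨Ideal.Quotient.mkₐ k m⟩⟩

open scoped TensorProduct in
/-- A finitely generated domain of characteristic zero specializes to a number field without
killing nonzero algebraic elements. -/
theorem exists_ringHom_numberField (A : Type) [CommRing A] [IsDomain A] [CharZero A]
    [Algebra.FiniteType ℤ A] :
    ∃ (K : Type) (_ : Field K) (_ : NumberField K) (φ : A →+* K),
      ∀ a : A, IsAlgebraic ℤ a → a ≠ 0 → φ a ≠ 0 := by
  obtain ⟨L, _, g, hg⟩ : ∃ (L : Type) (_ : Field L) (g : A →+* L), Function.Injective g :=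
    ⟨FractionRing A, inferInstance, algebraMap A _, FaithfulSMul.algebraMap_injective A _⟩
  have : CharZero L := charZero_of_injective_ringHom hg
  have : Nontrivial (ℚ ⊗[ℤ] A) := (Algebra.TensorProduct.productMap
    (algebraMap ℚ L).toIntAlgHom g.toIntAlgHom).toRingHom.domain_nontrivial
  obtain ⟨K, _, _, _, ⟨ψ⟩⟩ := Algebra.FiniteType.exists_algHom_finite_field ℚ (ℚ ⊗[ℤ] A)
  have : NumberField K := NumberField.of_module_finite ℚ K
  refine ⟨K, inferInstance, this,
    ψ.toRingHom.comp Algebra.TensorProduct.includeRight.toRingHom, fun a ha ha0 => ?_⟩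
  -- A nonzero algebraic element divides a nonzero integer, which survives in characteristic zero.
  obtain ⟨r, hr, c, hc⟩ := ha.exists_nonzero_dvd (mem_nonZeroDivisors_of_ne_zero ha0)
  intro h0
  have := congrArg (ψ.toRingHom.comp
    (Algebra.TensorProduct.includeRight (R := ℤ) (A := ℚ) (B := A)).toRingHom) hc
  rw [map_mul, h0, zero_mul, eq_intCast, map_intCast] at this
  exact hr (Int.cast_eq_zero.1 this)

open PrimeSpectrum in
/-- The image of a dominant morphism of finite presentation contains a nonempty basic open set. -/
theorem PrimeSpectrum.exists_basicOpen_subset_range {R A : Type*} [CommRing R] [IsDomain R]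
    [CommRing A] [IsDomain A] (g : R →+* A) (hg : g.FinitePresentation)
    (hinj : Function.Injective g) :
    ∃ f : R, f ≠ 0 ∧ ∀ p : PrimeSpectrum R, f ∉ p.asIdeal → p ∈ Set.range (comap g) := by
  obtain ⟨s, hs⟩ := exists_constructibleSetData_iff.2 (isConstructible_range_comap hg)
  -- The image is constructible and contains the generic point; the piece containing that point has
  -- only zero equations, so it is a basic open set.
  have hbot : (⊥ : PrimeSpectrum R) ∈ Set.range (comap g) := by
    refine ⟨⊥, PrimeSpectrum.ext ?_⟩
    change Ideal.comap g ⊥ = ⊥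
    exact (RingHom.injective_iff_ker_eq_bot g).1 hinj
  rw [← hs] at hbot
  simp only [ConstructibleSetData.toSet, Set.mem_iUnion] at hbot
  obtain ⟨C, hC, h1, h2⟩ := hbot
  have hg0 : ∀ i, C.g i = 0 := fun i => h1 ⟨i, rfl⟩
  refine ⟨C.f, fun h => h2 ?_, fun p hp => ?_⟩
  · rintro _ rfl
    exact h
  · rw [← hs]
    simp only [ConstructibleSetData.toSet, Set.mem_iUnion]
    refine ⟨C, hC, ?_, fun h => hp (h rfl)⟩
    rintro _ ⟨i, rfl⟩
    rw [hg0 i]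
    exact p.asIdeal.zero_mem

open Polynomial in
-- The image of `Spec A` in `Spec ℤ[X]` contains some `D(f)`. Cyclotomic polynomials of degree
-- exceeding that of `f` generate primes in `D(f)`, and a prime of `A` above such a prime contains
-- the value at `x`.
theorem exists_cyclotomic_not_isUnit_of_transcendental {A : Type*} [CommRing A] [IsDomain A]
    [Algebra.FiniteType ℤ A] {x : A} (hx : Transcendental ℤ x) {l : ℕ} (hl : l.Prime) (e : ℕ) :
    ∃ N ≥ e, ¬ IsUnit (aeval x (cyclotomic (l ^ (N + 1)) ℤ)) := by
  let g : ℤ[X] →+* A := (aeval x).toRingHom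
  have hft : g.FiniteType := by
    refine RingHom.FiniteType.of_comp_finiteType (f := algebraMap ℤ ℤ[X]) ?_
    have : g.comp (algebraMap ℤ ℤ[X]) = algebraMap ℤ A := RingHom.ext_int _ _
    rw [this]
    exact RingHom.finiteType_algebraMap.2 inferInstance
  obtain ⟨f, hf0, hf⟩ := PrimeSpectrum.exists_basicOpen_subset_range g
    (RingHom.FinitePresentation.of_finiteType.1 hft) (transcendental_iff_injective.1 hx)
  refine ⟨max e f.natDegree, le_max_left _ _, fun hu => ?_⟩
  set N := max e f.natDegree
  have hpos : 0 < l ^ (N + 1) := pow_pos hl.pos _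
  have hprime : Prime (cyclotomic (l ^ (N + 1)) ℤ) := (cyclotomic.irreducible hpos).prime
  have hp : (Ideal.span {cyclotomic (l ^ (N + 1)) ℤ}).IsPrime :=
    (Ideal.span_singleton_prime hprime.ne_zero).2 hprime
  obtain ⟨q, hq⟩ := hf ⟨_, hp⟩ (fun h => by
    have h1 := natDegree_le_of_dvd (Ideal.mem_span_singleton.1 h) hf0
    rw [natDegree_cyclotomic, Nat.totient_prime_pow_succ hl] at h1
    have h2 : N < l ^ N := Nat.lt_pow_self hl.one_lt
    have h3 : l ^ N ≤ l ^ N * (l - 1) := Nat.le_mul_of_pos_right _ (by have := hl.two_le; omega)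
    have h4 : f.natDegree ≤ N := le_max_right _ _
    omega)
  have hmem : cyclotomic (l ^ (N + 1)) ℤ ∈ (PrimeSpectrum.comap g q).asIdeal := by
    rw [hq]
    exact Ideal.mem_span_singleton_self _
  exact q.isPrime.ne_top (Ideal.eq_top_of_isUnit_mem _ hmem hu)

theorem exists_geom_sum_not_isUnit (A : Type) [CommRing A] [IsDomain A] [CharZero A]
    [Algebra.FiniteType ℤ A] (x : Aˣ) (hx : ∀ k : ℕ, 0 < k → x ^ k ≠ 1) {l : ℕ} (hl : l.Prime)
    (e : ℕ) :
    ∃ m : ℕ, 0 < m ∧ l ^ e ∣ m ∧ ¬ IsUnit (∑ i ∈ Finset.range l, ((x : A) ^ m) ^ i) := by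
  by_cases ht : Transcendental ℤ (x : A)
  · obtain ⟨N, hN, h⟩ := exists_cyclotomic_not_isUnit_of_transcendental ht hl e
    refine ⟨l ^ N, pow_pos hl.pos _, pow_dvd_pow _ hN, ?_⟩
    rw [Polynomial.cyclotomic_prime_pow_eq_geom_sum hl] at h
    simpa using h
  · have hxa : IsAlgebraic ℤ (x : A) := not_not.1 ht
    obtain ⟨K, _, _, φ, hφ⟩ := exists_ringHom_numberField A
    by_contra! hcon
    obtain ⟨T, hT⟩ := (inferInstance : Algebra.FiniteType ℤ A).out
    have hfin : ∀ t : A, {v : NumberField.FinitePlace K | 1 < v (φ t)}.Finite := by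
      intro t
      by_cases h0 : φ t = 0
      · simp [h0, not_lt.2 zero_le_one]
      · exact (NumberField.FinitePlace.hasFiniteMulSupport h0).subset fun v hv => ne_of_gt hv
    -- `S` collects the poles of the generators, so `φ` maps `A` into the `S`-integers and units of
    -- `A` to `S`-units.
    have hS : (⋃ t ∈ T, {v : NumberField.FinitePlace K | 1 < v (φ t)}).Finite :=
      T.finite_toSet.biUnion fun t _ => hfin t
    have hle : ∀ v ∉ hS.toFinset, ∀ a : A, v (φ a) ≤ 1 := by
      intro v hv a
      simp only [Set.Finite.mem_toFinset, Set.mem_iUnion, not_exists, Set.mem_ofPred_eq, not_lt] at hv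
      have ha : a ∈ Algebra.adjoin ℤ (T : Set A) := by rw [hT]; trivial
      induction ha using Algebra.adjoin_induction with
      | mem t ht => exact hv t ht
      | algebraMap r =>
        have := NumberField.HeightOneSpectrum.adicAbv_intCast_le_one K v.maximalIdeal r
        rw [← NumberField.FinitePlace.norm_embedding, NumberField.FinitePlace.norm_embedding_eq] at this
        simpa using this
      | add a b _ _ ha hb => rw [map_add]; exact (v.add_le _ _).trans (max_le ha hb)
      | mul a b _ _ ha hb => rw [map_mul, map_mul]; exact mul_le_one₀ ha (apply_nonneg _ _) hb
    obtain ⟨m, hm, hdm, v, hv, hv1⟩ := NumberField.exists_geom_sum_ne_one hS.toFinset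
      (x := φ x) (hφ _ hxa x.ne_zero) (fun k hk h => by
        refine hφ ((x : A) ^ k - 1) ((hxa.pow k).sub isAlgebraic_one) ?_ (by simp [h])
        rw [sub_ne_zero]
        exact fun h => hx k hk (Units.ext (by simpa using h))) (fun v hv => hle v hv x) hl.two_le (pow_pos hl.pos e)
    obtain ⟨u, hu⟩ := hcon m hm hdm
    apply hv1
    have e1 : φ u = ∑ i ∈ Finset.range l, (φ x ^ m) ^ i := by rw [hu]; simp
    rw [← e1]
    refine le_antisymm (hle v hv _) ?_
    have h1 : v (φ u) * v (φ (u⁻¹ : Aˣ)) = 1 := by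
      rw [← map_mul, ← map_mul, Units.mul_inv, map_one, map_one]
    nlinarith [hle v hv (u⁻¹ : Aˣ), apply_nonneg v (φ u)]

instance Int.isJacobsonRing : IsJacobsonRing ℤ := by
  refine isJacobsonRing_iff_prime_eq.2 fun P hP => ?_
  by_cases h : P = ⊥
  · subst h
    -- If `x` lies in the Jacobson radical then `x * x + 1` is a unit, so `x = 0`.
    refine eq_bot_iff.2 fun x hx => ?_
    rcases Int.isUnit_iff.1 (Ideal.mem_jacobson_bot.1 hx x) with h1 | h1
    · simpa using h1
    · nlinarith [mul_self_nonneg x]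
  · have := hP.isMaximal h
    exact Ideal.jacobson_eq_self_of_isMaximal

theorem Algebra.FiniteType.exists_ringHom_field_of_not_isUnit.{u} {A : Type u} [CommRing A]
    [Algebra.FiniteType ℤ A] {u : A} (hu : ¬ IsUnit u) :
    ∃ (F : Type u) (_ : Field F) (_ : Algebra.FiniteType ℤ F) (φ : A →+* F), φ u = 0 := by
  obtain ⟨I, hI, hmem⟩ := exists_max_ideal_of_mem_nonunits hu
  have hft : Algebra.FiniteType ℤ (A ⧸ I) :=
    Algebra.FiniteType.of_surjective (Ideal.Quotient.mkₐ ℤ I) (Ideal.Quotient.mkₐ_surjective ℤ I)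
  exact ⟨A ⧸ I, Ideal.Quotient.field I, hft, Ideal.Quotient.mk I,
    Ideal.Quotient.eq_zero_iff_mem.2 hmem⟩

/-- Since `ℤ` is Jacobson, `F` is a finite `ℤ`-module; characteristic zero would make `ℤ` a field.
-/
theorem finite_of_field_of_finiteType_int (F : Type*) [Field F] [Algebra.FiniteType ℤ F] :
    Finite F := by
  have hfin := finite_of_finite_type_of_isJacobsonRing ℤ F
  obtain ⟨p, hp⟩ := CharP.exists F
  rcases Nat.eq_zero_or_pos p with rfl | hp0
  · have : CharZero F := CharP.charP_to_charZero F
    have : IsField ℤ := isField_of_isIntegral_of_isField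
      (FaithfulSMul.algebraMap_injective ℤ F) (Field.toIsField F)
    exact absurd this Int.not_isField
  · have := NeZero.of_pos hp0
    let _ := ZMod.algebra F p
    have : Module.Finite (ZMod p) F := Module.Finite.of_restrictScalars_finite ℤ (ZMod p) F
    exact Module.finite_of_finite (ZMod p)

/-- A unit of infinite order in a finitely generated domain of characteristic zero in which `l` is
invertible has, in suitable finite residue fields, order divisible by any given power of `l`. -/
theorem exists_finite_field_dvd_orderOf (A : Type) [CommRing A] [IsDomain A] [CharZero A]
    [Algebra.FiniteType ℤ A] (x : Aˣ) (hx : ∀ k : ℕ, 0 < k → x ^ k ≠ 1) {l : ℕ} (hl : l.Prime)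
    (hlu : IsUnit (l : A)) (e : ℕ) :
    ∃ (F : Type) (_ : Field F) (_ : Finite F) (φ : A →+* F), l ^ e ∣ orderOf (φ x) := by
  obtain ⟨m, hm, hdm, hu⟩ := exists_geom_sum_not_isUnit A x hx hl e
  obtain ⟨F, _, _, φ, hφ⟩ := Algebra.FiniteType.exists_ringHom_field_of_not_isUnit hu
  refine ⟨F, inferInstance, finite_of_field_of_finiteType_int _, φ, ?_⟩
  set y := φ x
  have hsum : ∑ i ∈ Finset.range l, (y ^ m) ^ i = 0 := by
    simpa using hφ
  -- Otherwise the sum would equal `l`, which is invertible in `F`. So `y ^ m` has order exactly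
  -- `l`.
  have h1 : y ^ m ≠ 1 := by
    intro h
    rw [h] at hsum
    simp only [one_pow, Finset.sum_const, Finset.card_range, nsmul_eq_mul, mul_one] at hsum
    have := hlu.map φ
    rw [map_natCast, hsum] at this
    exact not_isUnit_zero this
  have h2 : (y ^ m) ^ l = 1 := by
    rw [← sub_eq_zero, ← geom_sum_mul, hsum, zero_mul]
  obtain ⟨a, b, hb, hab⟩ := Nat.exists_eq_pow_mul_and_not_dvd ((isOfFinOrder_iff_pow_eq_one (x := y)).2
    ⟨m * l, Nat.mul_pos hm hl.pos, by rw [pow_mul, h2]⟩).orderOf_pos.ne' l hl.ne_one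
  obtain ⟨c, rfl⟩ := hdm
  rw [hab]
  refine Dvd.dvd.mul_right (pow_dvd_pow l ?_) b
  -- If `a < e`, the order `l ^ a * b` of `y` would already divide `m`, against `h1`.
  by_contra! hae
  rw [← pow_mul] at h2
  have h3 := orderOf_dvd_of_pow_eq_one h2
  rw [hab] at h3
  have hbl : ∀ k, b.Coprime (l ^ k) := fun k =>
    (Nat.Coprime.pow_left k ((Nat.Prime.coprime_iff_not_dvd hl).2 hb)).symm
  have h4 : b ∣ c := by
    have h5 : b ∣ l ^ (e + 1) * c := by
      refine (Dvd.intro_left _ rfl).trans (h3.trans (dvd_of_eq ?_))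
      ring
    exact (hbl _).dvd_of_dvd_mul_left h5
  exact h1 (orderOf_dvd_iff_pow_eq_one.1 (hab ▸ mul_dvd_mul (pow_dvd_pow l hae.le) h4))

/-! ### Finite quotients of linear groups -/

open Matrix in
/-- If `μ` is an eigenvalue of `B` and `B ^ k` is unipotent, then `μ ^ k = 1`. -/
theorem Matrix.pow_eq_one_of_eigenvalue {n : ℕ} {F : Type*} [Field F]
    {B : Matrix (Fin n) (Fin n) F} {μ : F} (hμ : (Matrix.scalar (Fin n) μ - B).det = 0)
    {k r : ℕ} (h : (B ^ k - 1) ^ r = 0) : μ ^ k = 1 := by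
  obtain ⟨v, hv, hv0⟩ := Matrix.exists_mulVec_eq_zero_iff.2 hμ
  have h1 : B *ᵥ v = μ • v := by
    rw [Matrix.sub_mulVec, sub_eq_zero] at hv0
    rw [← hv0]
    simp [Matrix.scalar_apply, ← Matrix.smul_one_eq_diagonal, Matrix.smul_mulVec]
  have h2 : ∀ j : ℕ, (B ^ j) *ᵥ v = μ ^ j • v := by
    intro j
    induction j with
    | zero => simp
    | succ j ih => rw [pow_succ, ← Matrix.mulVec_mulVec, h1, Matrix.mulVec_smul, ih, smul_smul,
        pow_succ, mul_comm]
  have h3 : ∀ j : ℕ, ((B ^ k - 1) ^ j) *ᵥ v = (μ ^ k - 1) ^ j • v := by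
    intro j
    induction j with
    | zero => simp
    | succ j ih =>
      rw [pow_succ, ← Matrix.mulVec_mulVec, Matrix.sub_mulVec, h2, Matrix.one_mulVec,
        show μ ^ k • v - v = (μ ^ k - 1) • v by rw [sub_smul, one_smul], Matrix.mulVec_smul, ih,
        smul_smul, pow_succ, mul_comm]
  have h4 := h3 r
  rw [h, Matrix.zero_mulVec, eq_comm, smul_eq_zero] at h4
  exact sub_eq_zero.1 (eq_zero_of_pow_eq_zero (h4.resolve_right hv))

/-- A finitely generated group of complex matrices has entries in a finitely generated ring, which
may be taken to contain any given finite set. -/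
theorem Subgroup.FG.exists_subalgebra {n : ℕ} {Λ : Subgroup (GL (Fin n) ℂ)} (hΛ : Λ.FG)
    (T : Finset ℂ) :
    ∃ A : Subalgebra ℤ ℂ, Algebra.FiniteType ℤ A ∧ (∀ t ∈ T, t ∈ A) ∧
      Λ ≤ (Matrix.GeneralLinearGroup.map (n := Fin n) A.val.toRingHom).range := by
  classical
  obtain ⟨S, hS⟩ := hΛ
  let E : Finset ℂ := S.biUnion fun g => Finset.univ.biUnion fun i => Finset.univ.biUnion fun j =>
    {(g : Matrix (Fin n) (Fin n) ℂ) i j, ((g⁻¹ : GL (Fin n) ℂ) : Matrix (Fin n) (Fin n) ℂ) i j}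
  have hE : ∀ g ∈ S, ∀ i j, (g : Matrix (Fin n) (Fin n) ℂ) i j ∈ E ∧
      ((g⁻¹ : GL (Fin n) ℂ) : Matrix (Fin n) (Fin n) ℂ) i j ∈ E := by
    intro g hg i j
    simp only [E, Finset.mem_biUnion, Finset.mem_univ, true_and, Finset.mem_insert,
      Finset.mem_singleton]
    exact ⟨⟨g, hg, i, j, .inl rfl⟩, ⟨g, hg, i, j, .inr rfl⟩⟩
  let A := Algebra.adjoin ℤ ((T ∪ E : Finset ℂ) : Set ℂ)
  have hA : ∀ t ∈ T ∪ E, t ∈ A := fun t ht => Algebra.subset_adjoin ht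
  refine ⟨A, Algebra.FiniteType.adjoin_of_finite (T ∪ E).finite_toSet,
    fun t ht => hA t (Finset.mem_union_left _ ht), ?_⟩
  rw [← hS, Subgroup.closure_le]
  intro g hg
  have hE' := hE g hg
  let a : Matrix (Fin n) (Fin n) A := fun i j => ⟨g.1 i j, hA _ (Finset.mem_union_right _ (hE' i j).1)⟩
  let b : Matrix (Fin n) (Fin n) A :=
    fun i j => ⟨(g⁻¹).1 i j, hA _ (Finset.mem_union_right _ (hE' i j).2)⟩
  have ha : A.val.toRingHom.mapMatrix a = g.1 := rfl
  have hb : A.val.toRingHom.mapMatrix b = (g⁻¹).1 := rfl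
  have hinj : Function.Injective (A.val.toRingHom.mapMatrix (m := Fin n)) :=
    Matrix.map_injective Subtype.val_injective
  refine ⟨⟨a, b, hinj ?_, hinj ?_⟩, Units.ext ha⟩
  · rw [map_mul, ha, hb, map_one]
    exact g.mul_inv
  · rw [map_mul, ha, hb, map_one]
    exact g.inv_mul

theorem LinearGroup.exists_finiteIndex_prime_pow_dvd {n : ℕ} {Λ Γ : Subgroup (GL (Fin n) ℂ)}
    (hΛ : Λ.FG) (hΓ : LinearGroup.IsVirtuallyUnipotent Γ) {η : Λ}
    (hη : LinearGroup.IsSemisimple (η : GL (Fin n) ℂ)) (hinf : ¬ IsOfFinOrder (η : GL (Fin n) ℂ))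
    {l : ℕ} (hl : l.Prime) (e : ℕ) :
    ∃ M : Subgroup Λ, M.Normal ∧ M.FiniteIndex ∧
      ∀ γ ∈ Γ.subgroupOf Λ, ∀ k : ℤ, γ⁻¹ * η ^ k ∈ M → ((l ^ e : ℕ) : ℤ) ∣ k := by
  obtain ⟨d, hd, hΓd⟩ := hΓ.exists_pow
  obtain ⟨z, hz0, hz1, hz⟩ := hη.exists_eigenvalue hinf
  obtain ⟨A, hA, hT, hΛA⟩ := hΛ.exists_subalgebra {z, z⁻¹, (l : ℂ)⁻¹}
  have hinj : Function.Injective A.val.toRingHom := Subtype.val_injective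
  have hinjM : Function.Injective (A.val.toRingHom.mapMatrix (m := Fin n)) :=
    Matrix.map_injective hinj
  have hinjG : Function.Injective (Matrix.GeneralLinearGroup.map (n := Fin n) A.val.toRingHom) :=
    fun a b h => Units.ext (hinjM (congrArg Units.val h))
  let x : Aˣ := ⟨⟨z, hT _ (by simp)⟩, ⟨z⁻¹, hT _ (by simp)⟩,
    Subtype.ext (mul_inv_cancel₀ hz0), Subtype.ext (inv_mul_cancel₀ hz0)⟩
  have hx : ∀ k : ℕ, 0 < k → x ^ k ≠ 1 := fun k hk h => by
    refine hz1 k hk ?_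
    have := congrArg (fun u : Aˣ => ((u : A) : ℂ)) h
    simpa [x] using this
  have hlu : IsUnit (l : A) := by
    refine IsUnit.of_mul_eq_one ⟨(l : ℂ)⁻¹, hT _ (by simp)⟩ (Subtype.ext ?_)
    simpa using mul_inv_cancel₀ (Nat.cast_ne_zero.2 hl.ne_zero)
  obtain ⟨a, b, hb, hab⟩ := Nat.exists_eq_pow_mul_and_not_dvd hd.ne' l hl.ne_one
  -- The extra `a` absorbs the `l`-part of `d`, since only `k * d` is controlled.
  obtain ⟨F, _, _, φ, hφ⟩ := exists_finite_field_dvd_orderOf A x hx hl hlu (e + a)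
  let lift : Λ →* GL (Fin n) A :=
    (MonoidHom.ofInjective hinjG).symm.toMonoidHom.comp (Subgroup.inclusion hΛA)
  have hlift : ∀ g : Λ, A.val.toRingHom.mapMatrix (lift g : Matrix (Fin n) (Fin n) A) =
      ((g : GL (Fin n) ℂ) : Matrix (Fin n) (Fin n) ℂ) := fun g => by
    have := congrArg Subtype.val
      ((MonoidHom.ofInjective hinjG).apply_symm_apply (Subgroup.inclusion hΛA g))
    exact congrArg Units.val this
  let ρ : Λ →* GL (Fin n) F := (Matrix.GeneralLinearGroup.map φ).comp lift
  have hρ : ∀ g : Λ, (ρ g : Matrix (Fin n) (Fin n) F) = φ.mapMatrix (lift g).1 := fun g => rfl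
  have hdet : (Matrix.scalar (Fin n) (φ x) - (ρ η : Matrix (Fin n) (Fin n) F)).det = 0 := by
    have h1 : (Matrix.scalar (Fin n) (x : A) - (lift η : Matrix (Fin n) (Fin n) A)).det = 0 := by
      apply hinj
      rw [RingHom.map_det, map_sub, hlift, map_zero, ← hz]
      congr 2
      simp [Matrix.scalar_apply, Matrix.diagonal_map, x]
    have h2 := congrArg φ h1
    rw [RingHom.map_det, map_sub, map_zero] at h2
    rw [← h2, hρ]
    congr 2
    simp [Matrix.scalar_apply, Matrix.diagonal_map]
  have hunip : ∀ γ ∈ Γ.subgroupOf Λ, ((ρ γ : Matrix (Fin n) (Fin n) F) ^ d - 1) ^ n = 0 := by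
    intro γ hγ
    have h1 : ((lift γ : Matrix (Fin n) (Fin n) A) ^ d - 1) ^ n = 0 := by
      apply hinjM
      rw [map_pow, map_sub, map_pow, hlift, map_one, map_zero]
      exact hΓd _ hγ
    have h2 := congrArg φ.mapMatrix h1
    rwa [map_pow, map_sub, map_pow, map_one, map_zero] at h2
  have hnat : ∀ γ ∈ Γ.subgroupOf Λ, ∀ k : ℕ, ρ γ = ρ η ^ k → l ^ e ∣ k := by
    intro γ hγ k hk
    have h1 := hunip γ hγ
    rw [hk, Units.val_pow_eq_pow_val, ← pow_mul] at h1
    have h2 := orderOf_dvd_of_pow_eq_one (Matrix.pow_eq_one_of_eigenvalue hdet h1)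
    have h3 : l ^ a * l ^ e ∣ l ^ a * (k * b) := by
      refine (dvd_of_eq ?_).trans ((hφ.trans h2).trans (dvd_of_eq ?_))
      · ring
      · rw [hab]; ring
    have h4 := Nat.dvd_of_mul_dvd_mul_left (pow_pos hl.pos a) h3
    exact (Nat.Coprime.pow_left e ((Nat.Prime.coprime_iff_not_dvd hl).2 hb)).dvd_of_dvd_mul_right h4
  refine ⟨ρ.ker, inferInstance, Subgroup.finiteIndex_ker ρ, fun γ hγ k hk => ?_⟩
  have hk' : ρ γ = ρ η ^ k := by
    rw [MonoidHom.mem_ker, map_mul, map_inv, map_zpow] at hk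
    exact inv_mul_eq_one.1 hk
  rw [Int.natCast_dvd]
  obtain ⟨j, rfl | rfl⟩ := k.eq_nat_or_neg
  · exact hnat γ hγ _ (by simpa using hk')
  -- A negative exponent is reduced to a natural one by inverting `γ`.
  · exact hnat γ⁻¹ (inv_mem hγ) _ (by rw [map_inv, hk']; simp)

theorem mainTheorem12 (n : ℕ) (Λ Γ C : Subgroup (GL (Fin n) ℂ))
    (hΛ : Λ.FG)
    (hΓΛ : Γ ≤ Λ)
    (hΓ_torsionFree : LinearGroup.IsTorsionFree Γ)
    (hΓ_virtuallyUnipotent : LinearGroup.IsVirtuallyUnipotent Γ)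
    (hCΛ : C ≤ Λ)
    (hC_infinite : Infinite C)
    (hC_cyclic : ∃ η : GL (Fin n) ℂ, LinearGroup.IsSemisimple η ∧ C = Subgroup.zpowers η) :
    LinearGroup.profiniteClosure (Γ.subgroupOf Λ) ∩
      LinearGroup.profiniteClosure (C.subgroupOf Λ) = {1} := by
  obtain ⟨η, hη, rfl⟩ := hC_cyclic
  have hηΛ : η ∈ Λ := hCΛ (Subgroup.mem_zpowers η)
  have hinf : ¬ IsOfFinOrder η := by
    rw [← finite_zpowers]
    exact hC_infinite.not_finite
  have hC : (Subgroup.zpowers η).subgroupOf Λ = Subgroup.zpowers (⟨η, hηΛ⟩ : Λ) := by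
    ext g
    simp only [Subgroup.mem_subgroupOf, Subgroup.mem_zpowers_iff, Subtype.ext_iff,
      SubgroupClass.coe_zpow]
  rw [hC]
  refine LinearGroup.profiniteClosure_inter_zpowers fun m hm => ?_
  have key := fun l : m.primeFactors => LinearGroup.exists_finiteIndex_prime_pow_dvd hΛ
    hΓ_virtuallyUnipotent (η := ⟨η, hηΛ⟩) hη hinf (Nat.prime_of_mem_primeFactors l.2)
    (m.factorization l)
  choose M hM1 hM2 hM3 using key
  refine ⟨⨅ l, M l, Subgroup.normal_iInf_normal hM1, Subgroup.finiteIndex_iInf hM2,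
    fun γ hγ k hk => ?_⟩
  rw [Int.natCast_dvd, ← Nat.prod_factorization_pow_eq_self hm.ne', Finsupp.prod,
    Nat.support_factorization]
  refine Finset.prod_dvd_of_isRelPrime (fun p hp q hq hpq => ?_) fun l hl => ?_
  · exact Nat.coprime_iff_isRelPrime.1 (Nat.coprime_pow_primes _ _ (Nat.prime_of_mem_primeFactors hp)
      (Nat.prime_of_mem_primeFactors hq) hpq)
  · exact Int.natCast_dvd.1 (hM3 ⟨l, hl⟩ γ hγ k (Subgroup.mem_iInf.1 hk ⟨l, hl⟩))
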